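/- Let $n\ge 2$, let $a_1\ge a_2\ge\dots\ge a_n\ge 0$ be real numbers, not all zero, and let $q>0$. For $x\in\mathbb R^n$ let $x_1^*\ge\dots\ge x_n^*$ be the non-increasing rearrangement of $|x_1|,\dots,|x_n|$, and let the Lorentz space $\ell_{w,q}^n$ be $\mathbb R^n$ with the norm ($q$-norm if $q<1$) $$\|x\|=\bigl(a_1(x_1^*)^q+\dots+a_n(x_n^*)^q\bigr)^{1/q}.$$ For a measure space $(\Omega,\mu)$ let $L_q(\mu)$ be the space of (classes of) real measurable functions $f$ with $\|f\|_q=\bigl(\int|f|^q\,d\mu\bigr)^{1/q}<\infty$, and let $L_q=L_q(0,1)$ with Lebesgue measure. We say that $\ell_{w,q}^n$ is isometric to a subspace of $L_q(\mu)$ if there is a linear map $T:\mathbb R^n\to L_q(\mu)$ with $\|Tx\|_q=\|x\|$ for all $x$. (a) Let $0<q\le 1$. Then $\ell_{w,q}^n$ is isometric to a subspace of $L_q$ if and only if $$a_1-a_2=a_2-a_3=\dots=a_{n-1}-a_n ,$$ and this condition is also necessary for $\ell_{w,q}^n$ to be isometric to a subspace of $L_q(\mu)$ for an arbitrary measure space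 $(\Omega,\mu)$. In particular, for $n=2$ the space $\ell_{w,q}^2$ is isometric to a subspace of $L_q$ for every choice of $a_1,a_2$. (b) Let $q>1$. Then $\ell_{w,q}^n$ is isometric to a subspace of $L_q$ if and only if $a_1=\dots=a_n$, and this condition is also necessary for $\ell_{w,q}^n$ to be isometric to a subspace of $L_q(\mu)$ for an arbitrary measure space $(\Omega,\mu)$. If $a_1=\dots=a_n=c$, then $\|x\|=c^{1/q}\bigl(\sum_{i=1}^n|x_i|^q\bigr)^{1/q}$ for all $x\in\mathbb R^n$, so that up to this constant factor $\ell_{w,q}^n=\ell_q^n$. -/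

import Mathlib

open MeasureTheory

noncomputable section

/-- The non-increasing rearrangement `x* = (x*₁, …, x*ₙ)` of the numbers `|x₁|, …, |xₙ|`
(`Tuple.sort f` is a permutation that makes `f` non-decreasing). -/
def decreasingRearrangement {n : ℕ} (x : Fin n → ℝ) : Fin n → ℝ :=
  fun k => |x (Tuple.sort (fun i => -|x i|) k)|

theorem decreasingRearrangement_antitone {n : ℕ} (x : Fin n → ℝ) :
    Antitone (decreasingRearrangement x) := by
  intro i j hij
  have h := Tuple.monotone_sort (fun i => -|x i|) hij
  simpa [decreasingRearrangement] using h

/-- The norm (`q`-norm if `q < 1`) of the `n`-dimensional Lorentz space with weights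
`a₁ ≥ … ≥ aₙ ≥ 0`: `‖x‖ = (a₁ (x*₁)^q + … + aₙ (x*ₙ)^q)^(1/q)`. -/
def lorentzNorm {n : ℕ} (a : Fin n → ℝ) (q : ℝ) (x : Fin n → ℝ) : ℝ :=
  (∑ k, a k * decreasingRearrangement x k ^ q) ^ (1 / q)

/-- The `n`-dimensional Lorentz space with weights `a` and exponent `q` is (linearly) isometric to
a subspace of the real space `L_q(μ)`. For every `q > 0` the norm on `Lp` is
`‖f‖ = (∫ |f|^q dμ)^(1/q)`. -/
def LorentzEmbedsInLq {n : ℕ} (a : Fin n → ℝ) (q : ℝ) {Ω : Type*} [MeasurableSpace Ω]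
    (μ : Measure Ω) : Prop :=
  ∃ T : (Fin n → ℝ) →ₗ[ℝ] Lp ℝ (ENNReal.ofReal q) μ, ∀ x, ‖T x‖ = lorentzNorm a q x

/-- All consecutive differences agree: `a₁ - a₂ = a₂ - a₃ = … = aₙ₋₁ - aₙ`. -/
def EqualDifferences {n : ℕ} (a : Fin n → ℝ) : Prop :=
  ∀ (i j : ℕ) (hi : i + 1 < n) (hj : j + 1 < n),
    a ⟨i, Nat.lt_of_succ_lt hi⟩ - a ⟨i + 1, hi⟩ = a ⟨j, Nat.lt_of_succ_lt hj⟩ - a ⟨j + 1, hj⟩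

end

/-! Write N for the `q`-th power of the norm. Sufficiency, `q ≤ 1`: weights in arithmetic
progression make N a nonnegative combination of the functions |x_i|^q and max(|x_i|, |x_j|)^q
(`lorentzSum_eq_sum_max`). Since max(|x|, |y|) = |(x+y)/2| + |(x-y)/2|, it remains to represent
(|u|+|v|)^q. For `q < 1` this is, up to a constant, the mean of |uX+vY|^q with X, Y independent
Cauchy variables, by 1-stability; for `q = 1` the sum itself has the required form. The representing
finite measure on ℝⁿ is then transported to (0,1).

Necessity, `q < 2`: an embedding makes N(x - y) a kernel of negative type. Freeze all but two
coordinates p, r, with `k` others equal to z. Then D(s, z) = N(s+1/2, s-1/2, z) - N(s, s, z) is a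
positive definite function on the plane. For large s it is a first-order expression in the weights
of places 0, 1 when |z| is below s, and of places k, k+1 when |z| is above s. Positive definiteness
allows a jump of at most O(1/K) between these regimes at s = K - 1/2
(`card_mul_abs_sub_le_of_posDef`), while the jump is asymptotic to a constant times K^(q-1) unless
the consecutive differences of weights agree (`eq_of_forall_mul_abs_sub_le`).

Necessity, `q > 1`: t ↦ ‖f + tg‖^q is differentiable in L_q, whereas N has a corner where two
coordinates tie unless their two weights coincide (`LorentzEmbedsInLq.eq_succ`). -/

/-! ### Rearrangements and the `q`-th power of the norm -/

/-- The `q`-th power of the Lorentz norm. -/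
noncomputable def lorentzSum {n : ℕ} (a : Fin n → ℝ) (q : ℝ) (x : Fin n → ℝ) : ℝ :=
  ∑ k, a k * decreasingRearrangement x k ^ q

theorem decreasingRearrangement_eq_of_antitone {n : ℕ} (x : Fin n → ℝ) (σ : Equiv.Perm (Fin n))
    (h : Antitone fun k => |x (σ k)|) : decreasingRearrangement x = fun k => |x (σ k)| := by
  have h1 := (Tuple.comp_sort_eq_comp_iff_monotone (f := fun i => -|x i|) (σ := σ)).2
    (fun i j hij => neg_le_neg (h hij))
  funext k
  have h2 := congrFun h1 k
  simp only [Function.comp_apply, neg_inj] at h2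
  simp [decreasingRearrangement, h2]

theorem decreasingRearrangement_comp_perm {n : ℕ} (x : Fin n → ℝ) (σ : Equiv.Perm (Fin n)) :
    decreasingRearrangement (fun i => x (σ i)) = decreasingRearrangement x := by
  symm
  exact decreasingRearrangement_eq_of_antitone x
    (σ * Tuple.sort (fun i => -|x (σ i)|)) (decreasingRearrangement_antitone (fun i => x (σ i)))

theorem decreasingRearrangement_nonneg {n : ℕ} (x : Fin n → ℝ) (k : Fin n) :
    0 ≤ decreasingRearrangement x k := abs_nonneg _

theorem lorentzSum_nonneg {n : ℕ} {a : Fin n → ℝ} (ha : ∀ i, 0 ≤ a i) (q : ℝ) (x : Fin n → ℝ) :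
    0 ≤ lorentzSum a q x :=
  Finset.sum_nonneg fun k _ =>
    mul_nonneg (ha k) (Real.rpow_nonneg (decreasingRearrangement_nonneg x k) q)

theorem lorentzNorm_rpow {n : ℕ} {a : Fin n → ℝ} (ha : ∀ i, 0 ≤ a i) {q : ℝ} (hq : 0 < q)
    (x : Fin n → ℝ) : lorentzNorm a q x ^ q = lorentzSum a q x := by
  have h : lorentzNorm a q x = lorentzSum a q x ^ (1 / q) := rfl
  rw [h, ← Real.rpow_mul (lorentzSum_nonneg ha q x), one_div_mul_cancel hq.ne', Real.rpow_one]

theorem lorentzSum_comp_perm {n : ℕ} (a : Fin n → ℝ) (q : ℝ) (x : Fin n → ℝ)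
    (σ : Equiv.Perm (Fin n)) : lorentzSum a q (fun i => x (σ i)) = lorentzSum a q x := by
  simp only [lorentzSum, decreasingRearrangement_comp_perm]

theorem lorentzSum_neg {n : ℕ} (a : Fin n → ℝ) (q : ℝ) (x : Fin n → ℝ) :
    lorentzSum a q (-x) = lorentzSum a q x := by
  simp [lorentzSum, decreasingRearrangement]

theorem lorentzSum_eq_of_antitone {n : ℕ} (a : Fin n → ℝ) (q : ℝ) (x : Fin n → ℝ)
    (h : Antitone fun k => |x k|) : lorentzSum a q x = ∑ k, a k * |x k| ^ q := by
  simp only [lorentzSum, decreasingRearrangement_eq_of_antitone x 1 h, Equiv.Perm.coe_one, id]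

theorem lorentzSum_const {n : ℕ} (c q : ℝ) (x : Fin n → ℝ) :
    lorentzSum (fun _ => c) q x = c * ∑ i, |x i| ^ q := by
  rw [lorentzSum, ← Finset.mul_sum]
  congr 1
  exact Equiv.sum_comp (Tuple.sort fun i => -|x i|) (fun i => |x i| ^ q)

/-! ### Vectors with two free coordinates -/

/-- The vector `(z, …, z, p, r, 0, …, 0)` with `k` entries `z`. -/
def blockVector (n k : ℕ) (p r z : ℝ) : Fin n → ℝ := fun i =>
  if i.val < k then z else if i.val = k then p else if i.val = k + 1 then r else 0

theorem blockVector_sub (n k : ℕ) (p r z p' r' z' : ℝ) :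
    blockVector n k p r z - blockVector n k p' r' z'
      = blockVector n k (p - p') (r - r') (z - z') := by
  ext i
  simp only [Pi.sub_apply, blockVector]
  split_ifs <;> simp

theorem blockVector_neg (n k : ℕ) (p r z : ℝ) :
    blockVector n k (-p) (-r) (-z) = -blockVector n k p r z := by
  ext i
  simp only [Pi.neg_apply, blockVector]
  split_ifs <;> simp

theorem lorentzSum_blockVector_swap {n k : ℕ} (hk : k + 1 < n) (a : Fin n → ℝ) (q p r z : ℝ) :
    lorentzSum a q (blockVector n k p r z) = lorentzSum a q (blockVector n k r p z) := by
  rw [← lorentzSum_comp_perm a q (blockVector n k r p z)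
    (Equiv.swap ⟨k, Nat.lt_of_succ_lt hk⟩ ⟨k + 1, hk⟩)]
  congr 1
  ext i
  by_cases h1 : i = ⟨k, Nat.lt_of_succ_lt hk⟩
  · subst h1; simp [blockVector]
  by_cases h2 : i = ⟨k + 1, hk⟩
  · subst h2; simp [blockVector]
  rw [Equiv.swap_apply_of_ne_of_ne h1 h2]
  rw [Fin.ext_iff] at h1 h2
  simp only at h1 h2
  simp [blockVector, h1, h2]

theorem lorentzSum_blockVector_neg {n : ℕ} (k : ℕ) (a : Fin n → ℝ) (q p r z : ℝ) :
    lorentzSum a q (blockVector n k (-p) (-r) (-z)) = lorentzSum a q (blockVector n k p r z) := by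
  rw [blockVector_neg, lorentzSum_neg]

/-- Together with `lorentzSum_blockVector_of_ge` this gives the two regimes to be compared: the size
of z alone decides which weights the free coordinates receive. -/
theorem lorentzSum_blockVector_of_le {n k : ℕ} (hk : k + 1 < n) (a : Fin n → ℝ) {q : ℝ}
    (hq : 0 < q) {p r z : ℝ} (hpz : |p| ≤ |z|) (hrp : |r| ≤ |p|) :
    lorentzSum a q (blockVector n k p r z) =
      (∑ i : Fin n, if i.val < k then a i * |z| ^ q else 0)
        + a ⟨k, Nat.lt_of_succ_lt hk⟩ * |p| ^ q + a ⟨k + 1, hk⟩ * |r| ^ q := by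
  have hr0 := abs_nonneg r
  rw [lorentzSum_eq_of_antitone]
  · have h : ∀ i : Fin n, a i * |blockVector n k p r z i| ^ q =
        (if i.val < k then a i * |z| ^ q else 0)
        + (if i = ⟨k, Nat.lt_of_succ_lt hk⟩ then a i * |p| ^ q else 0)
        + (if i = ⟨k + 1, hk⟩ then a i * |r| ^ q else 0) := by
      intro i
      simp only [blockVector, Fin.ext_iff]
      split_ifs <;> first | omega | simp [Real.zero_rpow hq.ne']
    simp only [h, Finset.sum_add_distrib, Finset.sum_ite_eq', Finset.mem_univ, if_true]
  · intro i j hij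
    have hij' : i.val ≤ j.val := hij
    simp only [blockVector]
    split_ifs <;> first | omega | (simp; done) | linarith

/-- The permutation of `Fin n` that moves the positions `k`, `k + 1` to the front. -/
def bringToFront {n k : ℕ} (hk : k + 1 < n) : Equiv.Perm (Fin n) where
  toFun i := if h : i.val < k then ⟨i.val + 2, by omega⟩ else
    if i.val = k then ⟨0, by omega⟩ else if i.val = k + 1 then ⟨1, by omega⟩ else i
  invFun i := if i.val = 0 then ⟨k, by omega⟩ else if i.val = 1 then ⟨k + 1, hk⟩ else
    if i.val < k + 2 then ⟨i.val - 2, by omega⟩ else i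
  left_inv i := by grind
  right_inv i := by grind

theorem lorentzSum_blockVector_of_ge {n k : ℕ} (hk : k + 1 < n) (a : Fin n → ℝ) {q : ℝ}
    (hq : 0 < q) {p r z : ℝ} (hzr : |z| ≤ |r|) (hrp : |r| ≤ |p|) :
    lorentzSum a q (blockVector n k p r z) =
      (∑ i : Fin n, if 2 ≤ i.val ∧ i.val < k + 2 then a i * |z| ^ q else 0)
        + a ⟨0, by omega⟩ * |p| ^ q + a ⟨1, by omega⟩ * |r| ^ q := by
  have hz0 := abs_nonneg z
  let y : Fin n → ℝ := fun i =>
    if i.val = 0 then p else if i.val = 1 then r else if i.val < k + 2 then z else 0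
  have hy : blockVector n k p r z = fun i => y (bringToFront hk i) := by
    ext i
    simp only [blockVector, y, bringToFront, Equiv.coe_fn_mk]
    split_ifs <;> first | rfl | (simp at *; done) | (simp at *; omega)
  rw [hy, lorentzSum_comp_perm, lorentzSum_eq_of_antitone]
  · have h : ∀ i : Fin n, a i * |y i| ^ q =
        (if 2 ≤ i.val ∧ i.val < k + 2 then a i * |z| ^ q else 0)
        + (if i = ⟨0, by omega⟩ then a i * |p| ^ q else 0)
        + (if i = ⟨1, by omega⟩ then a i * |r| ^ q else 0) := by
      intro i
      simp only [y, Fin.ext_iff]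
      split_ifs <;> first | omega | simp [Real.zero_rpow hq.ne']
    simp only [h, Finset.sum_add_distrib, Finset.sum_ite_eq', Finset.mem_univ, if_true]
  · intro i j hij
    have hij' : i.val ≤ j.val := hij
    simp only [y]
    split_ifs <;> first | omega | (simp; done) | linarith

/-! ### Arithmetic weights and maxima over pairs -/

/-- The index `k` is the smaller one in `n - 1 - k` unordered pairs; each is counted twice. -/
theorem sum_sum_ne_min {n : ℕ} (g : Fin n → ℝ) :
    (∑ i, ∑ j, if i ≠ j then g (min i j) else 0) = 2 * ∑ k : Fin n, ((n : ℝ) - 1 - k) * g k := by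
  have h1 : ∀ i j : Fin n, (if i ≠ j then g (min i j) else 0)
      = (if i < j then g i else 0) + (if j < i then g j else 0) := by
    intro i j
    rcases lt_trichotomy i j with h | h | h
    · simp [h.ne, h, h.not_gt, min_eq_left h.le]
    · simp [h]
    · simp [h.ne', h, h.not_gt, min_eq_right h.le]
  have h2 : ∀ i : Fin n, (∑ j, if i < j then g i else 0) = ((n : ℝ) - 1 - i) * g i := by
    intro i
    rw [← Finset.sum_filter, Finset.sum_const, nsmul_eq_mul, Finset.filter_lt_eq_Ioi, Fin.card_Ioi,
      Nat.cast_sub (Nat.le_sub_one_of_lt i.isLt), Nat.cast_sub (Nat.one_le_of_lt i.isLt),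
      Nat.cast_one]
  simp only [h1, Finset.sum_add_distrib]
  rw [Finset.sum_comm (f := fun i j => if j < i then g j else 0)]
  simp only [h2]
  ring

/-- For weights in arithmetic progression, the Lorentz sum is a combination of the powers of the
coordinates and of the maxima over pairs of coordinates. -/
theorem lorentzSum_eq_sum_max {n : ℕ} (q b d : ℝ) (x : Fin n → ℝ) :
    lorentzSum (fun k : Fin n => b + d * ((n : ℝ) - 1 - k)) q x =
      (∑ i, ∑ j, if i ≠ j then d / 2 * max |x i| |x j| ^ q else 0) + ∑ i, b * |x i| ^ q := by
  let σ := Tuple.sort fun i => -|x i|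
  have e1 : (∑ i, b * |x i| ^ q) = ∑ i, b * decreasingRearrangement x i ^ q :=
    (Equiv.sum_comp σ (fun i => b * |x i| ^ q)).symm
  -- After sorting, the larger of two entries is the one with the smaller index.
  have e2 : (∑ i, ∑ j, if i ≠ j then d / 2 * max |x i| |x j| ^ q else 0) =
      ∑ i, ∑ j, if i ≠ j then d / 2 * decreasingRearrangement x (min i j) ^ q else 0 := by
    rw [← Equiv.sum_comp σ]
    refine Finset.sum_congr rfl fun i _ => ?_
    rw [← Equiv.sum_comp σ]
    refine Finset.sum_congr rfl fun j _ => ?_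
    rw [(decreasingRearrangement_antitone x).map_min]
    simp only [ne_eq, EmbeddingLike.apply_eq_iff_eq]
    rfl
  rw [e1, e2, sum_sum_ne_min (fun i => d / 2 * decreasingRearrangement x i ^ q), lorentzSum,
    Finset.mul_sum, ← Finset.sum_add_distrib]
  refine Finset.sum_congr rfl fun k _ => ?_
  ring

/-! ### Negative type of |x - y|^q -/

/-- Near 0 the bound 1 - cos u ≤ u²/2 leaves t^(1-q), integrable because `q < 2`; at infinity
2t^(-1-q) suffices because `q > 0`. -/
theorem integrableOn_one_sub_cos_mul_rpow {q : ℝ} (hq : 0 < q) (hq2 : q < 2) (y : ℝ) :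
    IntegrableOn (fun t : ℝ => (1 - Real.cos (t * y)) * t ^ (-1 - q)) (Set.Ioi 0) := by
  have hmeas : Measurable fun t : ℝ => (1 - Real.cos (t * y)) * t ^ (-1 - q) := by fun_prop
  rw [← Set.Ioc_union_Ioi_eq_Ioi zero_le_one]
  refine IntegrableOn.union ?_ ?_
  · have h := (intervalIntegral.intervalIntegrable_rpow' (a := 0) (b := 1)
      (show -1 < 1 - q by linarith)).1.const_mul (y ^ 2 / 2)
    refine Integrable.mono' h hmeas.aestronglyMeasurable ?_
    filter_upwards [ae_restrict_mem measurableSet_Ioc] with t ht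
    have h1 := Real.one_sub_sq_div_two_le_cos (x := t * y)
    have h2 := Real.cos_le_one (t * y)
    have h3 : t ^ (1 - q) = t ^ 2 * t ^ (-1 - q) := by
      rw [← Real.rpow_natCast, ← Real.rpow_add ht.1]; congr 1; push_cast; ring
    have h4 : 0 ≤ t ^ (-1 - q) := Real.rpow_nonneg ht.1.le _
    rw [Real.norm_of_nonneg (mul_nonneg (by linarith) h4), h3, ← mul_assoc]
    exact mul_le_mul_of_nonneg_right (by nlinarith) h4
  · have h := (integrableOn_Ioi_rpow_of_lt (show -1 - q < -1 by linarith) zero_lt_one).const_mul 2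
    refine Integrable.mono' h hmeas.aestronglyMeasurable ?_
    filter_upwards [ae_restrict_mem measurableSet_Ioi] with t ht
    have h1 := Real.neg_one_le_cos (t * y)
    have h2 := Real.cos_le_one (t * y)
    have h4 : 0 ≤ t ^ (-1 - q) := Real.rpow_nonneg (zero_le_one.trans (Set.mem_Ioi.1 ht).le) _
    rw [Real.norm_of_nonneg (mul_nonneg (by linarith) h4)]
    exact mul_le_mul_of_nonneg_right (by linarith) h4

theorem integral_one_sub_cos_mul_rpow {q : ℝ} (hq : 0 < q) (y : ℝ) :
    ∫ t in Set.Ioi (0 : ℝ), (1 - Real.cos (t * y)) * t ^ (-1 - q) =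
      (∫ t in Set.Ioi (0 : ℝ), (1 - Real.cos t) * t ^ (-1 - q)) * |y| ^ q := by
  rcases eq_or_ne y 0 with rfl | hy
  · simp [Real.zero_rpow hq.ne']
  have hy' : 0 < |y| := abs_pos.2 hy
  have h1 : ∫ t in Set.Ioi (0 : ℝ), (1 - Real.cos (t * y)) * t ^ (-1 - q) =
      ∫ t in Set.Ioi (0 : ℝ),
        |y| ^ (1 + q) * ((1 - Real.cos (t * |y|)) * (t * |y|) ^ (-1 - q)) := by
    refine setIntegral_congr_fun measurableSet_Ioi fun t ht => ?_
    have e1 : Real.cos (t * |y|) = Real.cos (t * y) := by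
      rcases abs_choice y with h | h <;> rw [h]
      rw [mul_neg, Real.cos_neg]
    have e2 : |y| ^ (1 + q) * |y| ^ (-1 - q) = 1 := by
      rw [← Real.rpow_add hy']; simp
    rw [e1, Real.mul_rpow (le_of_lt ht) hy'.le]
    linear_combination (-(1 - Real.cos (t * y)) * t ^ (-1 - q)) * e2
  rw [h1, integral_const_mul, integral_comp_mul_right_Ioi
    (fun t => (1 - Real.cos t) * t ^ (-1 - q)) 0 hy', zero_mul, smul_eq_mul, Real.rpow_add hy',
    Real.rpow_one]
  field_simp

theorem integral_one_sub_cos_mul_rpow_pos {q : ℝ} (hq : 0 < q) (hq2 : q < 2) :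
    0 < ∫ t in Set.Ioi (0 : ℝ), (1 - Real.cos t) * t ^ (-1 - q) := by
  have hint := integrableOn_one_sub_cos_mul_rpow hq hq2 1
  simp only [mul_one] at hint
  have hnn : ∀ t ∈ Set.Ioi (0 : ℝ), 0 ≤ (1 - Real.cos t) * t ^ (-1 - q) := fun t ht =>
    mul_nonneg (by linarith [Real.cos_le_one t]) (Real.rpow_nonneg (le_of_lt ht) _)
  rw [setIntegral_pos_iff_support_of_nonneg_ae
    ((ae_restrict_mem measurableSet_Ioi).mono hnn) hint]
  refine lt_of_lt_of_le ?_ (measure_mono (s := Set.Ioo 0 1) ?_)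
  · simp
  · intro t ht
    refine ⟨?_, ht.1⟩
    have h1 : Real.cos t < 1 := by
      rw [← Real.cos_zero]
      exact Real.cos_lt_cos_of_nonneg_of_le_pi le_rfl (by linarith [Real.pi_gt_three, ht.2]) ht.1
    exact (mul_pos (by linarith) (Real.rpow_pos_of_pos ht.1 _)).ne'

/-- For `0 < q < 2` the kernel `|x - y| ^ q` is of negative type. -/
theorem sum_sum_mul_abs_sub_rpow_nonpos {ι : Type*} [Fintype ι] {q : ℝ} (hq : 0 < q) (hq2 : q < 2)
    (c y : ι → ℝ) (hc : ∑ i, c i = 0) : ∑ i, ∑ j, c i * c j * |y i - y j| ^ q ≤ 0 := by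
  have hC := integral_one_sub_cos_mul_rpow_pos hq hq2
  set C := ∫ t in Set.Ioi (0 : ℝ), (1 - Real.cos t) * t ^ (-1 - q) with hCdef
  have h1 : C * ∑ i, ∑ j, c i * c j * |y i - y j| ^ q =
      ∫ t in Set.Ioi (0 : ℝ), ∑ i, ∑ j,
        c i * c j * ((1 - Real.cos (t * (y i - y j))) * t ^ (-1 - q)) := by
    rw [integral_finsetSum _ fun i _ => integrable_finsetSum _ fun j _ =>
      (integrableOn_one_sub_cos_mul_rpow hq hq2 _).const_mul _, Finset.mul_sum]
    refine Finset.sum_congr rfl fun i _ => ?_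
    rw [integral_finsetSum _ fun j _ =>
      (integrableOn_one_sub_cos_mul_rpow hq hq2 _).const_mul _, Finset.mul_sum]
    refine Finset.sum_congr rfl fun j _ => ?_
    rw [integral_const_mul, integral_one_sub_cos_mul_rpow hq]
    ring
  have h2 : C * ∑ i, ∑ j, c i * c j * |y i - y j| ^ q ≤ 0 := by
    rw [h1]
    refine setIntegral_nonpos measurableSet_Ioi fun t ht => ?_
    -- The cosine part is |∑ c_j e^(i t y_j)|², split into real and imaginary parts; the constant
    -- part vanishes since ∑ c_j = 0.
    have h3 : ∑ i, ∑ j, c i * c j * ((1 - Real.cos (t * (y i - y j))) * t ^ (-1 - q)) =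
        ((∑ i, c i) * (∑ j, c j) - (∑ i, c i * Real.cos (t * y i)) * (∑ j, c j * Real.cos (t * y j))
          - (∑ i, c i * Real.sin (t * y i)) * (∑ j, c j * Real.sin (t * y j))) * t ^ (-1 - q) := by
      simp only [Finset.sum_mul_sum, ← Finset.sum_sub_distrib]
      simp only [Finset.sum_mul]
      refine Finset.sum_congr rfl fun i _ => Finset.sum_congr rfl fun j _ => ?_
      rw [mul_sub t, Real.cos_sub]
      ring
    rw [h3, hc]
    refine mul_nonpos_of_nonpos_of_nonneg ?_ (Real.rpow_nonneg (le_of_lt ht) _)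
    nlinarith [mul_self_nonneg (∑ i, c i * Real.cos (t * y i)),
      mul_self_nonneg (∑ i, c i * Real.sin (t * y i))]
  exact nonpos_of_mul_nonpos_right h2 hC

/-! ### Embeddings give negative type -/

section Lp

variable {Ω : Type*} [MeasurableSpace Ω] {μ : Measure Ω}

theorem integrable_abs_rpow_Lp {q : ℝ} (hq : 0 < q) (f : Lp ℝ (ENNReal.ofReal q) μ) :
    Integrable (fun ω => |f ω| ^ q) μ := by
  have h := (Lp.memLp f).integrable_norm_rpow (by simpa using hq) ENNReal.ofReal_ne_top
  simpa [ENNReal.toReal_ofReal hq.le] using h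

theorem norm_rpow_Lp {q : ℝ} (hq : 0 < q) (f : Lp ℝ (ENNReal.ofReal q) μ) :
    ‖f‖ ^ q = ∫ ω, |f ω| ^ q ∂μ := by
  have h := (Lp.memLp f).eLpNorm_eq_integral_rpow_norm (by simpa using hq) ENNReal.ofReal_ne_top
  have h0 : 0 ≤ ∫ ω, |f ω| ^ q ∂μ := integral_nonneg fun ω => Real.rpow_nonneg (abs_nonneg _) _
  simp only [ENNReal.toReal_ofReal hq.le, Real.norm_eq_abs] at h
  rw [Lp.norm_def, h, ENNReal.toReal_ofReal (Real.rpow_nonneg h0 _), ← Real.rpow_mul h0,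
    inv_mul_cancel₀ hq.ne', Real.rpow_one]

theorem lorentzSum_eq_integral {n : ℕ} {a : Fin n → ℝ} (ha : ∀ i, 0 ≤ a i) {q : ℝ} (hq : 0 < q)
    {T : (Fin n → ℝ) →ₗ[ℝ] Lp ℝ (ENNReal.ofReal q) μ} (hT : ∀ x, ‖T x‖ = lorentzNorm a q x)
    (x : Fin n → ℝ) : lorentzSum a q x = ∫ ω, |T x ω| ^ q ∂μ := by
  rw [← lorentzNorm_rpow ha hq, ← hT, norm_rpow_Lp hq]

/-- If the Lorentz space embeds into `L_q` with `q < 2`, then the `q`-th power of its norm is of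
negative type. -/
theorem LorentzEmbedsInLq.sum_sum_lorentzSum_sub_nonpos {n : ℕ} {a : Fin n → ℝ}
    (ha : ∀ i, 0 ≤ a i) {q : ℝ} (hq : 0 < q) (hq2 : q < 2) (h : LorentzEmbedsInLq a q μ)
    {ι : Type*} [Fintype ι] (c : ι → ℝ) (hc : ∑ i, c i = 0) (X : ι → Fin n → ℝ) :
    ∑ i, ∑ j, c i * c j * lorentzSum a q (X i - X j) ≤ 0 := by
  obtain ⟨T, hT⟩ := h
  have hae : ∀ i j, (fun ω => |T (X i - X j) ω| ^ q) =ᵐ[μ]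
      fun ω => |T (X i) ω - T (X j) ω| ^ q := by
    intro i j
    rw [map_sub]
    filter_upwards [Lp.coeFn_sub (T (X i)) (T (X j))] with ω hω
    rw [hω, Pi.sub_apply]
  have hint : ∀ i j, Integrable (fun ω => |T (X i) ω - T (X j) ω| ^ q) μ := fun i j =>
    (integrable_abs_rpow_Lp hq _).congr (hae i j)
  have h1 : ∑ i, ∑ j, c i * c j * lorentzSum a q (X i - X j) =
      ∫ ω, ∑ i, ∑ j, c i * c j * |T (X i) ω - T (X j) ω| ^ q ∂μ := by
    rw [integral_finsetSum _ fun i _ => integrable_finsetSum _ fun j _ => (hint i j).const_mul _]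
    refine Finset.sum_congr rfl fun i _ => ?_
    rw [integral_finsetSum _ fun j _ => (hint i j).const_mul _]
    refine Finset.sum_congr rfl fun j _ => ?_
    rw [integral_const_mul, lorentzSum_eq_integral ha hq hT, integral_congr_ae (hae i j)]
  rw [h1]
  exact integral_nonpos fun ω => sum_sum_mul_abs_sub_rpow_nonpos hq hq2 c (fun i => T (X i) ω) hc

end Lp

/-! ### Necessity for `q < 2` -/

/-- Negative type is applied to the points with free coordinates s_i ± u/2, s_i ∓ u/2 and
coefficients ±c_i. These sum to zero for every c, so no condition on c remains. Pairs of equal sign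
give the second term, pairs of opposite sign the first, up to a swap. -/
theorem LorentzEmbedsInLq.sum_sum_sub_lorentzSum_nonneg {Ω : Type*} [MeasurableSpace Ω]
    {μ : Measure Ω} {n k : ℕ} (hk : k + 1 < n) {a : Fin n → ℝ}
    (ha : ∀ i, 0 ≤ a i) {q : ℝ} (hq : 0 < q) (hq2 : q < 2) (h : LorentzEmbedsInLq a q μ) (u : ℝ)
    {ι : Type*} [Fintype ι] (c s z : ι → ℝ) :
    0 ≤ ∑ i, ∑ j, c i * c j *
      (lorentzSum a q (blockVector n k (s i - s j + u) (s i - s j - u) (z i - z j))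
        - lorentzSum a q (blockVector n k (s i - s j) (s i - s j) (z i - z j))) := by
  let e : Bool → ℝ := fun b => if b then 1 else -1
  have h1 := h.sum_sum_lorentzSum_sub_nonpos ha hq hq2
    (ι := ι × Bool) (fun m => e m.2 * c m.1) (by simp [Fintype.sum_prod_type, e])
    (fun m => blockVector n k (s m.1 + e m.2 * (u / 2)) (s m.1 - e m.2 * (u / 2)) (z m.1))
  have h2 : ∀ i j, ∑ b : Bool, ∑ b' : Bool, e b * c i * (e b' * c j) *
      lorentzSum a q
        (blockVector n k (s i + e b * (u / 2)) (s i - e b * (u / 2)) (z i)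
          - blockVector n k (s j + e b' * (u / 2)) (s j - e b' * (u / 2)) (z j)) =
      -2 * (c i * c j *
      (lorentzSum a q (blockVector n k (s i - s j + u) (s i - s j - u) (z i - z j))
        - lorentzSum a q (blockVector n k (s i - s j) (s i - s j) (z i - z j)))) := by
    intro i j
    simp only [Fintype.sum_bool, blockVector_sub, e, if_true, Bool.false_eq_true, if_false]
    rw [lorentzSum_blockVector_swap hk a q
        (s i + -1 * (u / 2) - (s j + 1 * (u / 2))) (s i - -1 * (u / 2) - (s j - 1 * (u / 2)))]
    rw [show s i + 1 * (u / 2) - (s j + 1 * (u / 2)) = s i - s j by ring,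
      show s i - 1 * (u / 2) - (s j - 1 * (u / 2)) = s i - s j by ring,
      show s i + 1 * (u / 2) - (s j + -1 * (u / 2)) = s i - s j + u by ring,
      show s i - 1 * (u / 2) - (s j - -1 * (u / 2)) = s i - s j - u by ring,
      show s i + -1 * (u / 2) - (s j + 1 * (u / 2)) = s i - s j - u by ring,
      show s i - -1 * (u / 2) - (s j - 1 * (u / 2)) = s i - s j + u by ring,
      show s i + -1 * (u / 2) - (s j + -1 * (u / 2)) = s i - s j by ring,
      show s i - -1 * (u / 2) - (s j - -1 * (u / 2)) = s i - s j by ring]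
    ring
  simp only [Fintype.sum_prod_type] at h1
  have h3 : ∀ i, ∑ b : Bool, ∑ j, ∑ b' : Bool, e b * c i * (e b' * c j) *
      lorentzSum a q
        (blockVector n k (s i + e b * (u / 2)) (s i - e b * (u / 2)) (z i)
          - blockVector n k (s j + e b' * (u / 2)) (s j - e b' * (u / 2)) (z j)) =
      -2 * ∑ j, (c i * c j *
      (lorentzSum a q (blockVector n k (s i - s j + u) (s i - s j - u) (z i - z j))
        - lorentzSum a q (blockVector n k (s i - s j) (s i - s j) (z i - z j)))) := by
    intro i
    rw [Finset.sum_comm, Finset.mul_sum]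
    exact Finset.sum_congr rfl fun j _ => h2 i j
  simp only [h3, ← Finset.mul_sum] at h1
  linarith

/-- A positive definite kernel on the plane that, on the lines `s = 0` and `s = ± S`, takes two
values each: the values on `s = ± S` differ little. -/
theorem card_mul_abs_sub_le_of_posDef {K : ℕ} (D : ℝ → ℝ → ℝ) {S d₀ d₁ p₁ p₂ : ℝ}
    (hK : 0 < K) (hS : 0 ≤ S)
    (hpos : ∀ c s z : Bool × Bool × Fin K → ℝ,
      0 ≤ ∑ i, ∑ j, c i * c j * D (s i - s j) (z i - z j))
    (h00 : D 0 0 = d₀) (h01 : ∀ z, 1 ≤ |z| → D 0 z = d₁)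
    (h1 : ∀ s z : ℝ, |s| = S → |z| ≤ K - 1 → D s z = p₁)
    (h2 : ∀ s z : ℝ, |s| = S → K ≤ |z| → D s z = p₂) :
    K * |p₁ - p₂| ≤ d₀ - d₁ := by
  -- Two blocks of K consecutive integers: distances are at most K - 1 inside a block and at least K
  -- + 1 across blocks.
  let z : Bool → Fin K → ℝ := fun b i => i + if b then 2 * (K : ℝ) else 0
  have hlt : ∀ i : Fin K, (0 : ℝ) ≤ i ∧ (i : ℝ) ≤ K - 1 := by
    intro i
    have : ((i : ℕ) : ℝ) + 1 ≤ K := by exact_mod_cast i.isLt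
    exact ⟨Nat.cast_nonneg _, by linarith⟩
  have hz : ∀ b i j, z b i - z b j = (i : ℝ) - j := by intro b i j; simp only [z]; ring
  have hz1 : ∀ b i j, |z b i - z b j| ≤ K - 1 := by
    intro b i j
    rw [hz, abs_le]
    constructor <;> linarith [(hlt i).1, (hlt i).2, (hlt j).1, (hlt j).2]
  have hz2 : ∀ b i j, K ≤ |z b i - z (!b) j| := by
    intro b i j
    have := hlt i
    have := hlt j
    cases b
    · simp only [z, le_abs]; right; simp; linarith
    · simp only [z, le_abs]; left; simp; linarith
  have hK1 : (1 : ℝ) ≤ K := by exact_mod_cast hK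
  have hsame : ∀ b i, ∑ j, D 0 (z b i - z b j) = (d₀ - d₁) + K * d₁ := by
    intro b i
    have : ∀ j, D 0 (z b i - z b j) = (if j = i then d₀ - d₁ else 0) + d₁ := by
      intro j
      split_ifs with hij
      · subst hij; rw [sub_self, h00]; ring
      · rw [h01, zero_add]
        rw [hz]
        have h3 : (1 : ℤ) ≤ |((i : ℕ) : ℤ) - (j : ℕ)| :=
          Int.one_le_abs (sub_ne_zero.2 (by simpa [Fin.ext_iff, eq_comm] using hij))
        exact_mod_cast h3
    simp only [this, Finset.sum_add_distrib, Finset.sum_ite_eq', Finset.mem_univ, if_true,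
      Finset.sum_const, Finset.card_univ, Fintype.card_fin, nsmul_eq_mul]
  have hdiff : ∀ b i, ∑ j, D 0 (z b i - z (!b) j) = K * d₁ := by
    intro b i
    simp only [fun j => h01 _ (hK1.trans (hz2 b i j)), Finset.sum_const, Finset.card_univ,
      Fintype.card_fin, nsmul_eq_mul]
  have hS1 : ∀ s b i, |s| = S → ∑ j, D s (z b i - z b j) = K * p₁ := by
    intro s b i hs
    simp only [fun j => h1 s _ hs (hz1 b i j), Finset.sum_const, Finset.card_univ,
      Fintype.card_fin, nsmul_eq_mul]
  have hS2 : ∀ s b i, |s| = S → ∑ j, D s (z b i - z (!b) j) = K * p₂ := by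
    intro s b i hs
    simp only [fun j => h2 s _ hs (hz2 b i j), Finset.sum_const, Finset.card_univ,
      Fintype.card_fin, nsmul_eq_mul]
  -- Opposite signs on the two blocks cancel the bulk K d₁ along each line; the relative sign ε of
  -- the two lines gives both halves of the absolute value. Every row of the quadratic form has the
  -- same sum.
  have key : ∀ ε : ℝ, ε * ε = 1 → 0 ≤ (d₀ - d₁) + ε * (K * (p₁ - p₂)) := by
    intro ε hε
    let w : Bool → ℝ := fun e => if e then ε else 1
    let σ : Bool → ℝ := fun b => if b then -1 else 1
    let s : Bool → ℝ := fun e => if e then S else 0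
    have h := hpos (fun m => w m.1 * σ m.2.1) (fun m => s m.1) (fun m => z m.2.1 m.2.2)
    have hrow : ∀ e b i, ∑ m : Bool × Bool × Fin K,
        w e * σ b * (w m.1 * σ m.2.1) * D (s e - s m.1) (z b i - z m.2.1 m.2.2) =
        (d₀ - d₁) + ε * (K * (p₁ - p₂)) := by
      intro e b i
      have hs : |s e - s (!e)| = S := by cases e <;> simp [s, abs_of_nonneg hS]
      have hw : w e * w e = 1 := by cases e <;> simp [w, hε]
      have hw' : w e * w (!e) = ε := by cases e <;> simp [w]
      have hσ : σ b * σ b = 1 := by cases b <;> simp [σ]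
      have hσ' : σ b * σ (!b) = -1 := by cases b <;> simp [σ]
      have hb : ∀ (f : Bool → ℝ) (b : Bool), ∑ b', f b' = f b + f (!b) := by
        intro f b; cases b <;> simp [add_comm]
      simp only [Fintype.sum_prod_type]
      rw [hb _ e, hb _ b, hb _ b]
      simp only [← Finset.mul_sum, sub_self, hsame, hdiff, hS1 _ _ _ hs, hS2 _ _ _ hs]
      linear_combination ((d₀ - d₁) + K * d₁) * σ b * σ b * hw + ((d₀ - d₁) + K * d₁) * hσ
        + K * d₁ * σ b * σ (!b) * hw + K * d₁ * hσ' + K * p₁ * σ b * σ b * hw' + K * p₁ * ε * hσ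
        + K * p₂ * σ b * σ (!b) * hw' + K * p₂ * ε * hσ'
    have h' : 0 ≤ ∑ m : Bool × Bool × Fin K, ((d₀ - d₁) + ε * (K * (p₁ - p₂))) := by
      refine h.trans_eq (Finset.sum_congr rfl fun m _ => ?_)
      exact hrow m.1 m.2.1 m.2.2
    rw [Finset.sum_const, nsmul_eq_mul] at h'
    refine nonneg_of_mul_nonneg_right h' ?_
    simp [hK]
  have k1 := key 1 (by norm_num)
  have k2 := key (-1) (by norm_num)
  rw [← abs_of_pos (show (0 : ℝ) < K by linarith), ← abs_mul, abs_le]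
  constructor <;> linarith

/-- Both power differences are asymptotic to (q/2) K^(q-1), so the left side grows like (q/2) |α -
β| K^q. -/
theorem eq_of_forall_mul_abs_sub_le {q α β C : ℝ} (hq : 0 < q)
    (h : ∀ K : ℕ, 0 < K → K * |α * ((K : ℝ) ^ q - ((K : ℝ) - 1 / 2) ^ q)
      - β * (((K : ℝ) - 1 / 2) ^ q - ((K : ℝ) - 1) ^ q)| ≤ C) : α = β := by
  -- This is the bracket divided by K^q, at y = 1/K; its slope at 0 is (q/2)(α - β), and the
  -- hypothesis bounds the difference quotient by C K^(-q).
  let φ : ℝ → ℝ := fun y => α * (1 - (1 - y / 2) ^ q) - β * ((1 - y / 2) ^ q - (1 - y) ^ q)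
  have hd1 : HasDerivAt (fun y : ℝ => (1 - y / 2) ^ q) (-(q / 2)) 0 := by
    have h1 : HasDerivAt (fun y : ℝ => 1 - y / 2) (-(1 / 2)) 0 :=
      ((hasDerivAt_id (0 : ℝ)).div_const 2).const_sub 1
    convert h1.rpow_const (p := q) (Or.inl (by norm_num)) using 1
    simp; ring
  have hd2 : HasDerivAt (fun y : ℝ => (1 - y) ^ q) (-q) 0 := by
    have h1 : HasDerivAt (fun y : ℝ => 1 - y) (-1) 0 := (hasDerivAt_id (0 : ℝ)).const_sub 1
    convert h1.rpow_const (p := q) (Or.inl (by norm_num)) using 1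
    simp
  have hφ : HasDerivAt φ (α * -(-(q / 2)) - β * (-(q / 2) - -q)) 0 :=
    ((hd1.const_sub 1).const_mul α).sub ((hd1.sub hd2).const_mul β)
  have hinv : Filter.Tendsto (fun K : ℕ => (K : ℝ)⁻¹) Filter.atTop (nhdsWithin 0 {0}ᶜ) :=
    (tendsto_inv_atTop_nhdsGT_zero.comp tendsto_natCast_atTop_atTop).mono_right
      (nhdsWithin_mono 0 fun y hy => (Set.mem_Ioi.1 hy).ne')
  have hlim := (hasDerivAt_iff_tendsto_slope_zero.1 hφ).comp hinv
  have hlim0 : Filter.Tendsto (fun K : ℕ => C * ((K : ℝ)⁻¹) ^ q) Filter.atTop (nhds 0) := by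
    have h1 := (hinv.mono_right nhdsWithin_le_nhds).rpow_const (p := q) (Or.inr hq.le)
    simpa [Real.zero_rpow hq.ne'] using h1.const_mul C
  have hz : Filter.Tendsto ((fun t : ℝ => t⁻¹ • (φ (0 + t) - φ 0)) ∘ fun K : ℕ => (K : ℝ)⁻¹)
      Filter.atTop (nhds 0) := by
    refine squeeze_zero_norm' ?_ hlim0
    filter_upwards [Filter.eventually_gt_atTop 0] with K hK
    have hK0 : (0 : ℝ) < K := by exact_mod_cast hK
    have hK1 : (1 : ℝ) ≤ K := by exact_mod_cast hK
    have e0 : φ 0 = 0 := by simp [φ]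
    have e1 : (1 - (K : ℝ)⁻¹ / 2) = (K - 1 / 2) * (K : ℝ)⁻¹ := by field_simp
    have e2 : (1 - (K : ℝ)⁻¹) = (K - 1) * (K : ℝ)⁻¹ := by field_simp
    have e3 : (K : ℝ) ^ q * ((K : ℝ)⁻¹) ^ q = 1 := by
      rw [← Real.mul_rpow hK0.le (by positivity), mul_inv_cancel₀ hK0.ne', Real.one_rpow]
    have e4 : φ (K : ℝ)⁻¹ = (α * ((K : ℝ) ^ q - ((K : ℝ) - 1 / 2) ^ q)
      - β * (((K : ℝ) - 1 / 2) ^ q - ((K : ℝ) - 1) ^ q)) * ((K : ℝ)⁻¹) ^ q := by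
      simp only [φ]
      rw [e1, e2, Real.mul_rpow (by linarith) (by positivity),
        Real.mul_rpow (by linarith) (by positivity)]
      linear_combination -α * e3
    have hnn : 0 ≤ ((K : ℝ)⁻¹) ^ q := by positivity
    simp only [Function.comp_apply, zero_add, e0, sub_zero, inv_inv, smul_eq_mul, e4,
      Real.norm_eq_abs]
    rw [← mul_assoc, abs_mul, abs_mul, abs_of_nonneg hnn, abs_of_pos hK0]
    exact mul_le_mul_of_nonneg_right (h K hK) hnn
  have := tendsto_nhds_unique hlim hz
  have h2 : (q / 2) * (α - β) = 0 := by linarith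
  rcases mul_eq_zero.1 h2 with h3 | h3 <;> linarith

theorem LorentzEmbedsInLq.sub_eq_sub_zero {Ω : Type*} [MeasurableSpace Ω]
    {μ : Measure Ω} {n k : ℕ} (hk : k + 1 < n) {a : Fin n → ℝ}
    (ha : ∀ i, 0 ≤ a i) {q : ℝ} (hq : 0 < q) (hq2 : q < 2) (h : LorentzEmbedsInLq a q μ) :
    a ⟨k, Nat.lt_of_succ_lt hk⟩ - a ⟨k + 1, hk⟩ = a ⟨0, by omega⟩ - a ⟨1, by omega⟩ := by
  set ak := a ⟨k, Nat.lt_of_succ_lt hk⟩ with hak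
  set ak' := a ⟨k + 1, hk⟩ with hak'
  set a0 := a ⟨0, by omega⟩ with ha0
  set a1 := a ⟨1, by omega⟩ with ha1
  suffices a0 - ak = a1 - ak' by linarith
  refine eq_of_forall_mul_abs_sub_le (C := (a0 + a1) * (1 / 2) ^ q - (ak + ak') * (1 / 2) ^ q) hq
    fun K hK => ?_
  have hK1 : (1 : ℝ) ≤ K := by exact_mod_cast hK
  let D : ℝ → ℝ → ℝ := fun s z =>
    lorentzSum a q (blockVector n k (s + 1 / 2) (s - 1 / 2) z)
      - lorentzSum a q (blockVector n k s s z)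
  have hDneg : ∀ s z, D (-s) z = D s (-z) := by
    intro s z
    simp only [D]
    rw [← lorentzSum_blockVector_neg k a q (s + 1 / 2), ← lorentzSum_blockVector_neg k a q s,
      lorentzSum_blockVector_swap hk a q (-(s + 1 / 2)), neg_neg]
    ring_nf
  have hinner : ∀ s z : ℝ, 1 / 2 ≤ s → |z| ≤ s - 1 / 2 →
      D s z = a0 * ((s + 1 / 2) ^ q - s ^ q) - a1 * (s ^ q - (s - 1 / 2) ^ q) := by
    intro s z hs hz
    have e1 : |s + 1 / 2| = s + 1 / 2 := abs_of_nonneg (by linarith)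
    have e2 : |s - 1 / 2| = s - 1 / 2 := abs_of_nonneg (by linarith)
    have e3 : |s| = s := abs_of_nonneg (by linarith)
    simp only [D]
    rw [lorentzSum_blockVector_of_ge hk a hq (by rw [e2]; exact hz) (by rw [e1, e2]; linarith),
      lorentzSum_blockVector_of_ge hk a hq (by rw [e3]; linarith) le_rfl, e1, e2, e3]
    ring
  have houter : ∀ s z : ℝ, 1 / 2 ≤ s → s + 1 / 2 ≤ |z| →
      D s z = ak * ((s + 1 / 2) ^ q - s ^ q) - ak' * (s ^ q - (s - 1 / 2) ^ q) := by
    intro s z hs hz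
    have e1 : |s + 1 / 2| = s + 1 / 2 := abs_of_nonneg (by linarith)
    have e2 : |s - 1 / 2| = s - 1 / 2 := abs_of_nonneg (by linarith)
    have e3 : |s| = s := abs_of_nonneg (by linarith)
    simp only [D]
    rw [lorentzSum_blockVector_of_le hk a hq (by rw [e1]; exact hz) (by rw [e1, e2]; linarith),
      lorentzSum_blockVector_of_le hk a hq (by rw [e3]; linarith) le_rfl, e1, e2, e3]
    ring
  have hab : ∀ (s z p : ℝ), |s| = K - 1 / 2 →
      (∀ z', |z'| = |z| → D (K - 1 / 2) z' = p) → D s z = p := by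
    intro s z p hs hp
    rcases eq_or_eq_neg_of_abs_eq hs with h | h
    · rw [h, hp z rfl]
    · rw [h, hDneg, hp _ (abs_neg z)]
  -- With shift 1/2 and S = K - 1/2 the free coordinates are K and K - 1, matching the distances in
  -- the two blocks. The values d₀, d₁ on the line s = 0 do not depend on K.
  have main := card_mul_abs_sub_le_of_posDef D (K := K) (S := K - 1 / 2)
    (d₀ := (a0 + a1) * (1 / 2) ^ q) (d₁ := (ak + ak') * (1 / 2) ^ q)
    (p₁ := a0 * ((K : ℝ) ^ q - (K - 1 / 2) ^ q) - a1 * (((K : ℝ) - 1 / 2) ^ q - (K - 1) ^ q))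
    (p₂ := ak * ((K : ℝ) ^ q - (K - 1 / 2) ^ q) - ak' * (((K : ℝ) - 1 / 2) ^ q - (K - 1) ^ q))
    hK (by linarith)
    (fun c s z => h.sum_sum_sub_lorentzSum_nonneg hk ha hq hq2 (1 / 2) c s z) ?_ ?_ ?_ ?_
  · refine le_of_eq_of_le ?_ main
    congr 2
    ring
  · simp only [D]
    rw [lorentzSum_blockVector_of_ge hk a hq (by simp) (by simp),
      lorentzSum_blockVector_of_ge hk a hq le_rfl le_rfl]
    norm_num [Real.zero_rpow hq.ne', abs_of_pos]
    ring
  · intro z hz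
    simp only [D]
    rw [lorentzSum_blockVector_of_le hk a hq (by norm_num [abs_of_pos]; linarith) (by simp),
      lorentzSum_blockVector_of_le hk a hq (by simp) le_rfl]
    norm_num [Real.zero_rpow hq.ne', abs_of_pos]
    ring
  · intro s z hs hz
    refine hab s z _ hs fun z' hz' => ?_
    rw [hinner _ _ (by linarith) (by linarith)]
    ring_nf
  · intro s z hs hz
    refine hab s z _ hs fun z' hz' => ?_
    rw [houter _ _ (by linarith) (by linarith)]
    ring_nf

theorem LorentzEmbedsInLq.equalDifferences {Ω : Type*} [MeasurableSpace Ω]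
    {μ : Measure Ω} {n : ℕ} {a : Fin n → ℝ} (ha : ∀ i, 0 ≤ a i) {q : ℝ} (hq : 0 < q) (hq2 : q < 2)
    (h : LorentzEmbedsInLq a q μ) : EqualDifferences a := by
  intro i j hi hj
  rw [h.sub_eq_sub_zero hi ha hq hq2, h.sub_eq_sub_zero hj ha hq hq2]

/-! ### Necessity for `q > 1` -/

theorem hasDerivAt_integral_abs_add_mul_rpow {Ω : Type*} [MeasurableSpace Ω] {μ : Measure Ω}
    {q : ℝ} (hq : 1 < q) {f g : Ω → ℝ} (hf : MemLp f (ENNReal.ofReal q) μ)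
    (hg : MemLp g (ENNReal.ofReal q) μ) :
    HasDerivAt (fun t : ℝ => ∫ ω, |f ω + t * g ω| ^ q ∂μ)
      (∫ ω, q * |f ω + 0 * g ω| ^ (q - 2) * (f ω + 0 * g ω) * g ω ∂μ) 0 := by
  have hq0 : 0 < q := by linarith
  have hfg : ∀ t : ℝ, MemLp (fun ω => f ω + t * g ω) (ENNReal.ofReal q) μ := fun t =>
    hf.add (hg.const_mul t)
  have hint : ∀ h : Ω → ℝ, MemLp h (ENNReal.ofReal q) μ → Integrable (fun ω => |h ω| ^ q) μ := by
    intro h hh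
    have := hh.integrable_norm_rpow (by simpa using hq0) ENNReal.ofReal_ne_top
    simpa [ENNReal.toReal_ofReal hq0.le] using this
  have hbound : Integrable (fun ω => q * (|f ω| + |g ω|) ^ q) μ := by
    have := (hint _ (hf.norm.add hg.norm)).const_mul q
    refine this.congr (Filter.Eventually.of_forall fun ω => ?_)
    simp only [Pi.add_apply, Real.norm_eq_abs]
    rw [abs_of_nonneg (by positivity)]
  have hder : ∀ (ω : Ω) (t : ℝ), HasDerivAt (fun t : ℝ => |f ω + t * g ω| ^ q)
      (q * |f ω + t * g ω| ^ (q - 2) * (f ω + t * g ω) * g ω) t := by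
    intro ω t
    have h1 : HasDerivAt (fun t : ℝ => f ω + t * g ω) (g ω) t := by
      simpa using ((hasDerivAt_id t).mul_const (g ω)).const_add (f ω)
    exact (hasDerivAt_abs_rpow _ hq).comp t h1
  have hmf := hf.aestronglyMeasurable.aemeasurable
  have hmg := hg.aestronglyMeasurable.aemeasurable
  refine (hasDerivAt_integral_of_dominated_loc_of_deriv_le (F := fun t ω => |f ω + t * g ω| ^ q)
    (F' := fun t ω => q * |f ω + t * g ω| ^ (q - 2) * (f ω + t * g ω) * g ω)
    (bound := fun ω => q * (|f ω| + |g ω|) ^ q)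
    (Metric.ball_mem_nhds (0 : ℝ) one_pos) (Filter.Eventually.of_forall fun t =>
      (hint _ (hfg t)).aestronglyMeasurable) (hint _ (hfg 0)) ?_ ?_ hbound ?_).2
  · refine AEMeasurable.aestronglyMeasurable ?_
    fun_prop
  · refine Filter.Eventually.of_forall fun ω t ht => ?_
    have ht1 : |t| ≤ 1 := by simpa using (Metric.mem_ball.1 ht).le
    have h0 := abs_nonneg (f ω + t * g ω)
    have h1 : |f ω + t * g ω| ≤ |f ω| + |g ω| := by
      refine (abs_add_le _ _).trans ?_
      rw [abs_mul]
      nlinarith [abs_nonneg (g ω)]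
    -- The exponent q - 2 may be negative; where the base vanishes both sides are 0 because `q > 1`.
    have h2 : |f ω + t * g ω| ^ (q - 2) * |f ω + t * g ω| = |f ω + t * g ω| ^ (q - 1) := by
      rcases h0.eq_or_lt with h | h
      · rw [← h, Real.zero_rpow (sub_pos.2 hq).ne', mul_zero]
      · rw [← Real.rpow_add_one h.ne']; congr 1; ring
    have h3 : (|f ω| + |g ω|) ^ q = (|f ω| + |g ω|) ^ (q - 1) * (|f ω| + |g ω|) := by
      have hs : 0 ≤ |f ω| + |g ω| := by positivity
      rcases hs.eq_or_lt with h | h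
      · rw [← h, Real.zero_rpow hq0.ne', mul_zero]
      · rw [← Real.rpow_add_one h.ne']; congr 1; ring
    rw [Real.norm_eq_abs, abs_mul, abs_mul, abs_mul, abs_of_pos hq0,
      abs_of_nonneg (Real.rpow_nonneg h0 _), mul_assoc q, mul_assoc q, h2, h3]
    refine mul_le_mul_of_nonneg_left ?_ hq0.le
    refine mul_le_mul (Real.rpow_le_rpow h0 h1 (by linarith)) ?_ (abs_nonneg _) (by positivity)
    linarith [abs_nonneg (f ω)]
  · exact Filter.Eventually.of_forall fun ω t _ => hder ω t

/-- Along the free coordinates 1 + t, 1 - t the function N is even, by symmetry, and differentiable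
at 0, by the embedding, so its derivative there is 0. Its right derivative is q times the difference
of the two weights. The other entries 2 stay on top for t ≤ 1. -/
theorem LorentzEmbedsInLq.eq_succ {Ω : Type*} [MeasurableSpace Ω]
    {μ : Measure Ω} {n k : ℕ} (hk : k + 1 < n) {a : Fin n → ℝ}
    (ha : ∀ i, 0 ≤ a i) {q : ℝ} (hq : 1 < q) (h : LorentzEmbedsInLq a q μ) :
    a ⟨k, Nat.lt_of_succ_lt hk⟩ = a ⟨k + 1, hk⟩ := by
  have hq0 : 0 < q := by linarith
  obtain ⟨T, hT⟩ := h
  set ak := a ⟨k, Nat.lt_of_succ_lt hk⟩ with hak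
  set ak' := a ⟨k + 1, hk⟩ with hak'
  let Φ : ℝ → ℝ := fun t => lorentzSum a q (blockVector n k (1 + t) (1 - t) 2)
  obtain ⟨m, hm⟩ : ∃ m, HasDerivAt Φ m 0 := by
    refine ⟨_, (hasDerivAt_integral_abs_add_mul_rpow hq (Lp.memLp (T (blockVector n k 1 1 2)))
      (Lp.memLp (T (blockVector n k 1 (-1) 0)))).congr_of_eventuallyEq
      (Filter.Eventually.of_forall fun t => ?_)⟩
    have e : blockVector n k (1 + t) (1 - t) 2
        = blockVector n k 1 1 2 + t • blockVector n k 1 (-1) 0 := by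
      ext i
      simp only [blockVector, Pi.add_apply, Pi.smul_apply, smul_eq_mul]
      split_ifs <;> ring
    simp only [Φ]
    rw [lorentzSum_eq_integral ha hq0 hT, e, map_add, map_smul]
    refine integral_congr_ae ?_
    filter_upwards [Lp.coeFn_add (T (blockVector n k 1 1 2)) (t • T (blockVector n k 1 (-1) 0)),
      Lp.coeFn_smul t (T (blockVector n k 1 (-1) 0))] with ω h1 h2
    rw [h1, Pi.add_apply, h2, Pi.smul_apply, smul_eq_mul]
  obtain ⟨C, hC⟩ : ∃ C, ∀ t ∈ Set.Icc (0 : ℝ) 1,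
      Φ t = C + ak * (1 + t) ^ q + ak' * (1 - t) ^ q := by
    refine ⟨∑ i : Fin n, if i.val < k then a i * |2| ^ q else 0, fun t ht => ?_⟩
    have e1 : |1 + t| = 1 + t := abs_of_nonneg (by linarith [ht.1])
    have e2 : |1 - t| = 1 - t := abs_of_nonneg (by linarith [ht.2])
    simp only [Φ]
    rw [lorentzSum_blockVector_of_le hk a hq0
      (by rw [e1, abs_of_pos (by norm_num : (0 : ℝ) < 2)]; linarith [ht.2])
      (by rw [e1, e2]; linarith [ht.1]), e1, e2]
  have heven : ∀ t, Φ (-t) = Φ t := by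
    intro t
    simp only [Φ]
    rw [lorentzSum_blockVector_swap hk]
    ring_nf
  have hd : HasDerivAt (fun t : ℝ => C + ak * (1 + t) ^ q + ak' * (1 - t) ^ q)
      (q * (ak - ak')) 0 := by
    have d1 : HasDerivAt (fun t : ℝ => (1 + t) ^ q) q 0 := by
      have h1 : HasDerivAt (fun t : ℝ => 1 + t) 1 0 := (hasDerivAt_id (0 : ℝ)).const_add 1
      exact (h1.rpow_const (p := q) (Or.inl (by norm_num))).congr_deriv (by simp)
    have d2 : HasDerivAt (fun t : ℝ => (1 - t) ^ q) (-q) 0 := by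
      have h1 : HasDerivAt (fun t : ℝ => 1 - t) (-1) 0 := (hasDerivAt_id (0 : ℝ)).const_sub 1
      exact (h1.rpow_const (p := q) (Or.inl (by norm_num))).congr_deriv (by simp)
    exact (((d1.const_mul ak).const_add C).add (d2.const_mul ak')).congr_deriv (by ring)
  have hu : UniqueDiffWithinAt ℝ (Set.Icc (0 : ℝ) 1) 0 :=
    uniqueDiffOn_Icc zero_lt_one 0 (by simp)
  have h0 : (0 : ℝ) ∈ Set.Icc (0 : ℝ) 1 := by simp
  have hd' : HasDerivWithinAt Φ (q * (ak - ak')) (Set.Icc 0 1) 0 :=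
    hd.hasDerivWithinAt.congr hC (hC 0 h0)
  have hm' : HasDerivAt Φ (-m) 0 := by
    have h1 : HasDerivAt (fun t : ℝ => Φ (-t)) (-m) 0 := by
      have h2 : HasDerivAt Φ m (-0) := by simpa using hm
      simpa [Function.comp_def] using h2.comp (0 : ℝ) (hasDerivAt_neg (0 : ℝ))
    exact h1.congr_of_eventuallyEq (Filter.Eventually.of_forall fun t => (heven t).symm)
  have hm0 : m = -m := hm.unique hm'
  have e := hu.eq_deriv _ hd' hm.hasDerivWithinAt
  have : q * (ak - ak') = 0 := by linarith
  rcases mul_eq_zero.1 this with h3 | h3 <;> linarith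

theorem LorentzEmbedsInLq.eq_of_one_lt {Ω : Type*} [MeasurableSpace Ω]
    {μ : Measure Ω} {n : ℕ} {a : Fin n → ℝ} (ha : ∀ i, 0 ≤ a i) {q : ℝ} (hq : 1 < q)
    (h : LorentzEmbedsInLq a q μ) (i j : Fin n) : a i = a j := by
  have key : ∀ (m : ℕ) (hm : m < n), a ⟨m, hm⟩ = a ⟨0, by omega⟩ := by
    intro m
    induction m with
    | zero => intro _; rfl
    | succ m ih => intro hm; rw [← h.eq_succ hm ha hq, ih]
  rw [key i i.isLt, key j j.isLt]

/-! ### The Cauchy distribution: characteristic function, moments, stability -/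

theorem fourier_exp_neg_mul_abs {γ : NNReal} (hγ : γ ≠ 0) (w : ℝ) :
    FourierTransform.fourier (fun x : ℝ => (Real.exp (-(2 * Real.pi * γ) * |x|) : ℂ)) w
      = (ProbabilityTheory.cauchyPDFReal 0 γ w : ℂ) := by
  have hγ0 : (0 : ℝ) < γ := by positivity
  have hpi := Real.pi_pos
  let z : ℂ := 2 * Real.pi * γ + 2 * Real.pi * w * Complex.I
  let z' : ℂ := 2 * Real.pi * γ - 2 * Real.pi * w * Complex.I
  have hz : 0 < z.re := by simp [z]; positivity
  have hz' : 0 < z'.re := by simp [z']; positivity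
  have hzn : (-z).re < 0 := by simpa using hz
  have e1 : ∀ x ∈ Set.Ioi (0 : ℝ), Complex.exp (↑(-2 * Real.pi * x * w) * Complex.I) •
      (Real.exp (-(2 * Real.pi * γ) * |x|) : ℂ) = Complex.exp (-z * x) := by
    intro x hx
    rw [abs_of_pos hx, smul_eq_mul, Complex.ofReal_exp, ← Complex.exp_add]
    congr 1; simp only [z]; push_cast; ring
  have e2 : ∀ x ∈ Set.Iic (0 : ℝ), Complex.exp (↑(-2 * Real.pi * x * w) * Complex.I) •
      (Real.exp (-(2 * Real.pi * γ) * |x|) : ℂ) = Complex.exp (z' * x) := by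
    intro x hx
    rw [abs_of_nonpos hx, smul_eq_mul, Complex.ofReal_exp, ← Complex.exp_add]
    congr 1; simp only [z']; push_cast; ring
  rw [Real.fourier_real_eq_integral_exp_smul, ← intervalIntegral.integral_Iic_add_Ioi
    ((integrableOn_exp_mul_complex_Iic hz' 0).congr_fun (fun x hx => (e2 x hx).symm)
      measurableSet_Iic)
    ((integrableOn_exp_mul_complex_Ioi hzn 0).congr_fun (fun x hx => (e1 x hx).symm)
      measurableSet_Ioi),
    setIntegral_congr_fun measurableSet_Iic e2, setIntegral_congr_fun measurableSet_Ioi e1,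
    integral_exp_mul_complex_Iic hz', integral_exp_mul_complex_Ioi hzn]
  have hz0 : z ≠ 0 := fun h => by simp [h] at hz
  have hz0' : z' ≠ 0 := fun h => by simp [h] at hz'
  have hpos : w ^ 2 + (γ : ℝ) ^ 2 ≠ 0 := by positivity
  have hposC : (w : ℂ) ^ 2 + ((γ : ℝ) : ℂ) ^ 2 ≠ 0 := by exact_mod_cast hpos
  have hpiC : (Real.pi : ℂ) ≠ 0 := by exact_mod_cast hpi.ne'
  have hprod : z * z' = 4 * Real.pi ^ 2 * (w ^ 2 + ((γ : ℝ) : ℂ) ^ 2) := by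
    simp only [z, z']
    linear_combination (-4 * (Real.pi : ℂ) ^ 2 * w ^ 2) * Complex.I_sq
  have hsum : z + z' = 4 * Real.pi * ((γ : ℝ) : ℂ) := by simp only [z, z']; ring
  have h3 : (1 : ℂ) / z' + 1 / z = (z + z') / (z * z') := by field_simp
  simp only [Complex.ofReal_zero, mul_zero, Complex.exp_zero, ProbabilityTheory.cauchyPDFReal_def,
    sub_zero, neg_div_neg_eq]
  rw [h3, hprod, hsum]
  push_cast
  field_simp

theorem integrable_exp_neg_mul_abs {c : ℝ} (hc : 0 < c) :
    Integrable fun x : ℝ => (Real.exp (-c * |x|) : ℂ) := by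
  have h : Integrable fun x : ℝ => Real.exp (-c * |x|) := by
    rw [← integrableOn_univ, ← Set.Iic_union_Ioi (a := (0 : ℝ))]
    refine IntegrableOn.union ?_ ?_
    · refine (integrableOn_exp_mul_Iic hc 0).congr_fun (fun x hx => ?_) measurableSet_Iic
      simp [abs_of_nonpos (Set.mem_Iic.1 hx)]
    · refine (integrableOn_exp_mul_Ioi (neg_lt_zero.2 hc) 0).congr_fun (fun x hx => ?_)
        measurableSet_Ioi
      simp [abs_of_pos (Set.mem_Ioi.1 hx)]
  exact h.ofReal

/-- Fourier inversion of `fourier_exp_neg_mul_abs`; the argument t/(2π) converts between the two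
normalisations. -/
theorem charFun_cauchyMeasure {γ : NNReal} (hγ : γ ≠ 0) (t : ℝ) :
    charFun (ProbabilityTheory.cauchyMeasure 0 γ) t = (Real.exp (-γ * |t|) : ℂ) := by
  have hγ0 : (0 : ℝ) < γ := by positivity
  have hpi := Real.pi_pos
  let f : ℝ → ℂ := fun x => (Real.exp (-(2 * Real.pi * γ) * |x|) : ℂ)
  have hF : FourierTransform.fourier f
      = fun w => (ProbabilityTheory.cauchyPDFReal 0 γ w : ℂ) :=
    funext fun w => fourier_exp_neg_mul_abs hγ w
  have hf : Integrable f := integrable_exp_neg_mul_abs (by positivity)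
  have hinv : FourierTransformInv.fourierInv (FourierTransform.fourier f) (t / (2 * Real.pi))
      = (Real.exp (-(2 * Real.pi * γ) * |t / (2 * Real.pi)|) : ℂ) :=
    hf.fourierInv_fourier_eq (hF ▸ (ProbabilityTheory.integrable_cauchyPDFReal 0).ofReal)
      (Continuous.continuousAt (by fun_prop))
  rw [hF, Real.fourierInv_eq'] at hinv
  rw [charFun_apply_real, ProbabilityTheory.cauchyMeasure_of_scale_ne_zero 0 hγ]
  have hd : ProbabilityTheory.cauchyPDF 0 γ =
      fun x => ((ProbabilityTheory.cauchyPDFReal 0 γ x).toNNReal : ENNReal) := rfl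
  rw [hd, integral_withDensity_eq_integral_smul (by fun_prop)]
  have hR : -(2 * Real.pi * γ) * |t / (2 * Real.pi)| = -γ * |t| := by
    rw [abs_div, abs_of_pos (by positivity : 0 < 2 * Real.pi)]; field_simp
  rw [hR] at hinv
  rw [← hinv]
  refine integral_congr_ae (Filter.Eventually.of_forall fun x => ?_)
  have hx := (ProbabilityTheory.cauchyPDF_pos 0 hγ x).le
  simp only [NNReal.smul_def, Real.coe_toNNReal _ hx, Complex.real_smul, smul_eq_mul,
    RCLike.inner_apply, conj_trivial]
  rw [mul_comm]
  congr 2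
  have : (2 * Real.pi : ℝ) * (t / (2 * Real.pi) * x) = t * x := by field_simp
  simp [this, ← Complex.ofReal_mul]

theorem integrable_abs_rpow_cauchyMeasure {q : ℝ} (hq : 0 < q) (hq1 : q < 1) :
    Integrable (fun x : ℝ => |x| ^ q) (ProbabilityTheory.cauchyMeasure 0 1) := by
  rw [ProbabilityTheory.cauchyMeasure_of_scale_ne_zero 0 one_ne_zero]
  have hd : ProbabilityTheory.cauchyPDF 0 1 =
      fun x => ((ProbabilityTheory.cauchyPDFReal 0 1 x).toNNReal : ENNReal) := rfl
  rw [hd, integrable_withDensity_iff_integrable_smul (by fun_prop)]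
  -- The density decays like x^(-2), so |x|^q times it is dominated by a multiple of
  -- (1+|x|)^(-(2-q)), integrable since 2 - q > 1.
  have hb := (integrable_one_add_norm (E := ℝ) (μ := volume) (r := 2 - q)
    (by simp; linarith)).const_mul (2 * Real.pi⁻¹)
  refine hb.mono' (by fun_prop) (Filter.Eventually.of_forall fun x => ?_)
  have hx := (ProbabilityTheory.cauchyPDF_pos 0 (one_ne_zero (α := NNReal)) x).le
  have hpi := Real.pi_pos
  have h0 := abs_nonneg x
  have h1 : 0 < 1 + |x| := by positivity
  rw [NNReal.smul_def, Real.coe_toNNReal _ hx, smul_eq_mul, Real.norm_eq_abs,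
    abs_of_nonneg (by positivity), ProbabilityTheory.cauchyPDFReal_def, Real.norm_eq_abs]
  have h2 : (1 + |x|) ^ (-(2 - q)) = (1 + |x|) ^ q * ((1 + |x|) ^ 2)⁻¹ := by
    rw [← Real.rpow_natCast, ← Real.rpow_neg h1.le, ← Real.rpow_add h1]
    congr 1; push_cast; ring
  have h3 : |x| ^ q ≤ (1 + |x|) ^ q := Real.rpow_le_rpow h0 (by linarith) hq.le
  have h4 : (x ^ 2 + 1)⁻¹ ≤ 2 * ((1 + |x|) ^ 2)⁻¹ := by
    rw [← div_eq_mul_inv, inv_eq_one_div, div_le_div_iff₀ (by positivity) (by positivity)]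
    nlinarith [sq_nonneg (1 - |x|), sq_abs x]
  rw [h2]
  have h5 : (x ^ 2 + 1)⁻¹ * |x| ^ q ≤ 2 * ((1 + |x|) ^ 2)⁻¹ * (1 + |x|) ^ q :=
    mul_le_mul h4 h3 (by positivity) (by positivity)
  have h6 := mul_le_mul_of_nonneg_left h5 (inv_nonneg.2 hpi.le)
  simp only [NNReal.coe_one, sub_zero, one_pow, mul_one]
  linarith

theorem integral_abs_rpow_cauchyMeasure_pos {q : ℝ} (hq : 0 < q) (hq1 : q < 1) :
    0 < ∫ x : ℝ, |x| ^ q ∂(ProbabilityTheory.cauchyMeasure 0 1) := by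
  have hnn : ∀ x : ℝ, 0 ≤ |x| ^ q := fun x => by positivity
  rw [integral_pos_iff_support_of_nonneg hnn (integrable_abs_rpow_cauchyMeasure hq hq1)]
  have hs : Function.support (fun x : ℝ => |x| ^ q) = {0}ᶜ := by
    ext x
    simp [hq.ne']
  have h0 : ProbabilityTheory.cauchyMeasure 0 1 {(0 : ℝ)} = 0 := by
    rw [ProbabilityTheory.cauchyMeasure_of_scale_ne_zero 0 one_ne_zero]
    exact withDensity_absolutelyContinuous _ _ (measure_singleton 0)
  rw [hs, prob_compl_eq_one_sub (measurableSet_singleton 0), h0]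
  simp

/-- The Cauchy distribution is stable with index `1`. -/
theorem map_cauchyMeasure_prod (u v : ℝ) :
    ((ProbabilityTheory.cauchyMeasure 0 1).prod (ProbabilityTheory.cauchyMeasure 0 1)).map
        (fun p : ℝ × ℝ => u * p.1 + v * p.2) =
      (ProbabilityTheory.cauchyMeasure 0 1).map (fun x => (|u| + |v|) * x) := by
  refine Measure.ext_of_charFun (funext fun t => ?_)
  have hc : ∀ s : ℝ, charFun (ProbabilityTheory.cauchyMeasure 0 1) s = (Real.exp (-|s|) : ℂ) := by
    intro s
    simpa using charFun_cauchyMeasure (γ := 1) one_ne_zero s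
  have e1 : charFun (((ProbabilityTheory.cauchyMeasure 0 1).prod
      (ProbabilityTheory.cauchyMeasure 0 1)).map (fun p : ℝ × ℝ => u * p.1 + v * p.2)) t =
      charFun (ProbabilityTheory.cauchyMeasure 0 1) (t * u)
        * charFun (ProbabilityTheory.cauchyMeasure 0 1) (t * v) := by
    simp only [charFun_apply_real]
    rw [integral_map (by fun_prop) (by fun_prop), ← integral_prod_mul]
    refine integral_congr_ae (Filter.Eventually.of_forall fun p => ?_)
    dsimp only
    rw [← Complex.exp_add]
    congr 1
    push_cast
    ring
  have e2 : charFun ((ProbabilityTheory.cauchyMeasure 0 1).map (fun x => (|u| + |v|) * x)) t =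
      charFun (ProbabilityTheory.cauchyMeasure 0 1) (t * (|u| + |v|)) := by
    simp only [charFun_apply_real]
    rw [integral_map (by fun_prop) (by fun_prop)]
    refine integral_congr_ae (Filter.Eventually.of_forall fun x => ?_)
    dsimp only
    congr 1
    push_cast
    ring
  rw [e1, e2, hc, hc, hc, ← Complex.ofReal_mul, ← Real.exp_add]
  congr 2
  rw [abs_mul, abs_mul, abs_mul, abs_of_nonneg (by positivity : 0 ≤ |u| + |v|)]
  ring

theorem integral_abs_rpow_cauchyMeasure_prod {q : ℝ} (hq : 0 < q) (hq1 : q < 1) (u v : ℝ) :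
    Integrable (fun p : ℝ × ℝ => |u * p.1 + v * p.2| ^ q)
      ((ProbabilityTheory.cauchyMeasure 0 1).prod (ProbabilityTheory.cauchyMeasure 0 1)) ∧
    ∫ p : ℝ × ℝ, |u * p.1 + v * p.2| ^ q
        ∂((ProbabilityTheory.cauchyMeasure 0 1).prod (ProbabilityTheory.cauchyMeasure 0 1)) =
      (∫ x : ℝ, |x| ^ q ∂(ProbabilityTheory.cauchyMeasure 0 1)) * (|u| + |v|) ^ q := by
  have hmeas : Measurable fun y : ℝ => |y| ^ q := by fun_prop
  have e : ∀ x : ℝ, |(|u| + |v|) * x| ^ q = (|u| + |v|) ^ q * |x| ^ q := by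
    intro x
    have h0 : 0 ≤ |u| + |v| := by positivity
    rw [abs_mul, abs_of_nonneg h0, Real.mul_rpow h0 (abs_nonneg x)]
  constructor
  · refine (integrable_map_measure hmeas.aestronglyMeasurable (by fun_prop)).1 ?_
    rw [map_cauchyMeasure_prod, integrable_map_measure hmeas.aestronglyMeasurable (by fun_prop)]
    simp only [Function.comp_def, e]
    exact (integrable_abs_rpow_cauchyMeasure hq hq1).const_mul _
  · rw [← integral_map (f := fun y : ℝ => |y| ^ q) (by fun_prop) hmeas.aestronglyMeasurable,
      map_cauchyMeasure_prod, integral_map (by fun_prop) hmeas.aestronglyMeasurable]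
    simp only [e]
    rw [integral_const_mul, mul_comm]

/-! ### The cone of representable functions -/

/-- The function `Φ` on `ℝⁿ` is an integral of `q`-th powers of absolute values of linear
functionals with respect to a finite measure. -/
def IsLqRepresentable {n : ℕ} (q : ℝ) (Φ : (Fin n → ℝ) → ℝ) : Prop :=
  ∃ M : Measure (Fin n → ℝ), IsFiniteMeasure M ∧ ∀ x : Fin n → ℝ,
    Integrable (fun v : Fin n → ℝ => |∑ i, x i * v i| ^ q) M ∧
      ∫ v : Fin n → ℝ, |∑ i, x i * v i| ^ q ∂M = Φ x

namespace IsLqRepresentable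

variable {n : ℕ} {q : ℝ}

theorem measurable_abs_sum_rpow (q : ℝ) (x : Fin n → ℝ) :
    Measurable fun v : Fin n → ℝ => |∑ i, x i * v i| ^ q := by
  fun_prop

theorem zero : IsLqRepresentable (n := n) q fun _ => 0 :=
  ⟨0, inferInstance, fun _ => ⟨integrable_zero_measure, integral_zero_measure _⟩⟩

theorem add {Φ Ψ : (Fin n → ℝ) → ℝ} (hΦ : IsLqRepresentable q Φ) (hΨ : IsLqRepresentable q Ψ) :
    IsLqRepresentable q fun x => Φ x + Ψ x := by
  obtain ⟨M, hM, h⟩ := hΦ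
  obtain ⟨M', hM', h'⟩ := hΨ
  refine ⟨M + M', inferInstance, fun x => ⟨(h x).1.add_measure (h' x).1, ?_⟩⟩
  rw [integral_add_measure (h x).1 (h' x).1, (h x).2, (h' x).2]

theorem const_mul {Φ : (Fin n → ℝ) → ℝ} (hΦ : IsLqRepresentable q Φ) {c : ℝ} (hc : 0 ≤ c) :
    IsLqRepresentable q fun x => c * Φ x := by
  obtain ⟨M, hM, h⟩ := hΦ
  refine ⟨c.toNNReal • M, inferInstance, fun x => ⟨(h x).1.smul_measure_nnreal, ?_⟩⟩
  rw [integral_smul_nnreal_measure, (h x).2, NNReal.smul_def, Real.coe_toNNReal _ hc, smul_eq_mul]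

theorem sum {ι : Type*} (s : Finset ι) {Φ : ι → (Fin n → ℝ) → ℝ}
    (h : ∀ i ∈ s, IsLqRepresentable q (Φ i)) : IsLqRepresentable q fun x => ∑ i ∈ s, Φ i x := by
  classical
  induction s using Finset.induction_on with
  | empty => simpa using zero
  | insert i s hi ih =>
    simp only [Finset.sum_insert hi]
    exact (h i (Finset.mem_insert_self i s)).add
      (ih fun j hj => h j (Finset.mem_insert_of_mem hj))

theorem abs_sum_mul_rpow (q : ℝ) (w : Fin n → ℝ) :
    IsLqRepresentable q fun x : Fin n → ℝ => |∑ i, x i * w i| ^ q :=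
  ⟨Measure.dirac w, inferInstance, fun x =>
    ⟨integrable_dirac' (measurable_abs_sum_rpow q x).stronglyMeasurable (by simp),
      integral_dirac' _ _ (measurable_abs_sum_rpow q x).stronglyMeasurable⟩⟩

theorem abs_apply_rpow (q : ℝ) (i : Fin n) :
    IsLqRepresentable q fun x : Fin n → ℝ => |x i| ^ q := by
  simpa [Pi.single_apply] using abs_sum_mul_rpow q (Pi.single i (1 : ℝ))

theorem half_abs_add_add_half_abs_sub (x y : ℝ) :
    |(x + y) / 2| + |(x - y) / 2| = max |x| |y| := by
  rw [abs_div, abs_div, abs_of_pos (by norm_num : (0 : ℝ) < 2)]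
  rcases abs_cases x with h | h <;> rcases abs_cases y with h' | h' <;>
  rcases abs_cases (x + y) with h1 | h1 <;> rcases abs_cases (x - y) with h2 | h2 <;>
  rcases max_cases |x| |y| with h3 | h3 <;> linarith

/-- The maximum is |u| + |v| with u, v = (x_i ± x_j)/2. For `q < 1` the representing measure is the
law of a vector with uX + vY as its pairing with x, where X, Y are independent Cauchy variables. -/
theorem max_rpow (hq : 0 < q) (hq1 : q ≤ 1) (i j : Fin n) :
    IsLqRepresentable q fun x : Fin n → ℝ => max |x i| |x j| ^ q := by
  have hsum : ∀ (x : Fin n → ℝ) (s t : ℝ),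
      ∑ k, x k * (Pi.single i s + Pi.single j t : Fin n → ℝ) k = x i * s + x j * t := by
    intro x s t
    simp [Pi.single_apply, mul_add, Finset.sum_add_distrib]
  rcases hq1.lt_or_eq with hq1 | rfl
  · have hC := integral_abs_rpow_cauchyMeasure_pos hq hq1
    set C := ∫ x : ℝ, |x| ^ q ∂(ProbabilityTheory.cauchyMeasure 0 1)
    have hrep : IsLqRepresentable q fun x : Fin n → ℝ => C * max |x i| |x j| ^ q := by
      let V : ℝ × ℝ → Fin n → ℝ := fun p =>
        Pi.single i ((p.1 + p.2) / 2) + Pi.single j ((p.1 - p.2) / 2)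
      have hV : Measurable V := by
        refine measurable_pi_iff.2 fun k => ?_
        simp only [V, Pi.add_apply, Pi.single_apply]
        refine Measurable.add ?_ ?_ <;> split_ifs <;> fun_prop
      refine ⟨((ProbabilityTheory.cauchyMeasure 0 1).prod
        (ProbabilityTheory.cauchyMeasure 0 1)).map V, inferInstance, fun x => ?_⟩
      have h := integral_abs_rpow_cauchyMeasure_prod hq hq1 ((x i + x j) / 2) ((x i - x j) / 2)
      have e : ∀ p : ℝ × ℝ, (x i + x j) / 2 * p.1 + (x i - x j) / 2 * p.2
          = ∑ k, x k * V p k := by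
        intro p
        rw [hsum]
        ring
      simp only [e, half_abs_add_add_half_abs_sub] at h
      refine ⟨(integrable_map_measure (measurable_abs_sum_rpow q x).aestronglyMeasurable
        hV.aemeasurable).2 h.1, ?_⟩
      rw [integral_map hV.aemeasurable (measurable_abs_sum_rpow q x).aestronglyMeasurable]
      exact h.2
    have h := hrep.const_mul (inv_nonneg.2 hC.le)
    simpa only [inv_mul_cancel_left₀ hC.ne'] using h
  -- For exponent 1 the Cauchy moment is infinite, but two point masses suffice.
  · have h := (abs_sum_mul_rpow 1 (Pi.single i (1 / 2) + Pi.single j (1 / 2) : Fin n → ℝ)).add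
      (abs_sum_mul_rpow 1 (Pi.single i (1 / 2) + Pi.single j (-(1 / 2)) : Fin n → ℝ))
    simp only [hsum, Real.rpow_one] at h ⊢
    convert h using 2 with x
    rw [← half_abs_add_add_half_abs_sub]
    congr 2 <;> ring

end IsLqRepresentable

/-! ### Transport to (0,1) and conclusion -/

theorem exists_measurable_map_volume_Ioo_eq {Y : Type*} [Nonempty Y] [MeasurableSpace Y]
    [StandardBorelSpace Y] (P : Measure Y) [IsProbabilityMeasure P] :
    ∃ F : ℝ → Y, Measurable F ∧ (volume.restrict (Set.Ioo (0 : ℝ) 1)).map F = P := by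
  obtain ⟨f, hf, hfP⟩ := P.exists_measurable_map_eq
  have hproj : Measurable (Set.projIcc (0 : ℝ) 1 zero_le_one) := continuous_projIcc.measurable
  refine ⟨f ∘ Set.projIcc 0 1 zero_le_one, hf.comp hproj, ?_⟩
  rw [Measure.restrict_congr_set Ioo_ae_eq_Icc, ← unitInterval.measurePreserving_coe.map_eq,
    Measure.map_map (hf.comp hproj) measurable_subtype_coe, ← hfP]
  congr 1
  ext t : 1
  simp

/-- The normalised representing measure is the law of some F on (0,1); x is sent to the pairing of x
with F, scaled by the `q`-th root of the total mass. -/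
theorem IsLqRepresentable.lorentzEmbedsInLq {n : ℕ} {a : Fin n → ℝ} {q : ℝ}
    (hq : 0 < q) (h : IsLqRepresentable q (lorentzSum a q)) :
    LorentzEmbedsInLq a q (volume.restrict (Set.Ioo (0 : ℝ) 1)) := by
  obtain ⟨M, hM, hM0, h⟩ : ∃ M : Measure (Fin n → ℝ), IsFiniteMeasure M ∧ M ≠ 0 ∧
      ∀ x : Fin n → ℝ, Integrable (fun v : Fin n → ℝ => |∑ i, x i * v i| ^ q) M ∧
        ∫ v : Fin n → ℝ, |∑ i, x i * v i| ^ q ∂M = lorentzSum a q x := by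
    obtain ⟨M, hM, h⟩ := h
    have hd : ∀ x : Fin n → ℝ, Integrable (fun v : Fin n → ℝ => |∑ i, x i * v i| ^ q)
        (Measure.dirac 0) := fun x => integrable_dirac'
      (IsLqRepresentable.measurable_abs_sum_rpow q x).stronglyMeasurable (by simp)
    -- A point mass at 0 makes the measure nonzero, hence normalisable, and adds 0^q = 0 to every
    -- integral.
    refine ⟨M + Measure.dirac 0, inferInstance, ?_, fun x => ⟨(h x).1.add_measure (hd x), ?_⟩⟩
    · intro h0
      have := congrArg (fun ν : Measure (Fin n → ℝ) => ν Set.univ) h0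
      simp at this
    · rw [integral_add_measure (h x).1 (hd x), (h x).2, integral_dirac' _ _
        (IsLqRepresentable.measurable_abs_sum_rpow q x).stronglyMeasurable]
      simp [Real.zero_rpow hq.ne']
  have : NeZero M := ⟨hM0⟩
  obtain ⟨F, hF, hFP⟩ := exists_measurable_map_volume_Ioo_eq ((M Set.univ)⁻¹ • M)
  set ν := volume.restrict (Set.Ioo (0 : ℝ) 1) with hν
  set m : ℝ := (M Set.univ).toReal with hm
  have hmpos : 0 < m := ENNReal.toReal_pos (by simpa using hM0) (measure_ne_top _ _)
  have hκ : 0 ≤ m ^ (1 / q) := Real.rpow_nonneg hmpos.le _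
  have hκq : (m ^ (1 / q)) ^ q = m := by
    rw [← Real.rpow_mul hmpos.le, one_div_mul_cancel hq.ne', Real.rpow_one]
  let G : (Fin n → ℝ) → ℝ → ℝ := fun x ω => m ^ (1 / q) * ∑ i, x i * F ω i
  have hG : ∀ x, Measurable (G x) := by
    intro x
    have : ∀ i, Measurable fun ω => F ω i := fun i => (measurable_pi_apply i).comp hF
    fun_prop
  have hGq : ∀ x ω, |G x ω| ^ q = m * |∑ i, x i * F ω i| ^ q := by
    intro x ω
    rw [abs_mul, abs_of_nonneg hκ, Real.mul_rpow hκ (abs_nonneg _), hκq]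
  have hFint : ∀ x : Fin n → ℝ, Integrable (fun ω => |∑ i, x i * F ω i| ^ q) ν := by
    intro x
    refine (integrable_map_measure (f := F) (g := fun v : Fin n → ℝ => |∑ i, x i * v i| ^ q)
      (IsLqRepresentable.measurable_abs_sum_rpow q x).aestronglyMeasurable hF.aemeasurable).1 ?_
    rw [hFP]
    exact (h x).1.smul_measure (by simpa using hM0)
  have hGint : ∀ x, ∫ ω, |G x ω| ^ q ∂ν = lorentzSum a q x := by
    intro x
    simp only [hGq]
    rw [integral_const_mul, ← integral_map (f := fun v : Fin n → ℝ => |∑ i, x i * v i| ^ q)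
      hF.aemeasurable (IsLqRepresentable.measurable_abs_sum_rpow q x).aestronglyMeasurable, hFP,
      integral_smul_measure, (h x).2, ENNReal.toReal_inv, smul_eq_mul,
      mul_inv_cancel_left₀ hmpos.ne']
  have hmem : ∀ x, MemLp (G x) (ENNReal.ofReal q) ν := by
    intro x
    rw [← integrable_norm_rpow_iff (hG x).aestronglyMeasurable (by simpa using hq)
      ENNReal.ofReal_ne_top]
    simp only [ENNReal.toReal_ofReal hq.le, Real.norm_eq_abs, hGq]
    exact (hFint x).const_mul m
  let T : (Fin n → ℝ) →ₗ[ℝ] Lp ℝ (ENNReal.ofReal q) ν :=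
    { toFun := fun x => (hmem x).toLp (G x)
      map_add' := by
        intro x y
        rw [← MemLp.toLp_add]
        congr 1
        ext ω
        simp only [G, Pi.add_apply, add_mul, Finset.sum_add_distrib, mul_add]
      map_smul' := by
        intro c x
        rw [RingHom.id_apply, ← MemLp.toLp_const_smul]
        congr 1
        ext ω
        simp only [G, Pi.smul_apply, smul_eq_mul, mul_assoc, ← Finset.mul_sum]
        ring }
  refine ⟨T, fun x => ?_⟩
  have h1 : ‖T x‖ ^ q = lorentzSum a q x := by
    rw [norm_rpow_Lp hq, ← hGint x]
    refine integral_congr_ae ?_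
    filter_upwards [(hmem x).coeFn_toLp] with ω hω
    change |((hmem x).toLp (G x)) ω| ^ q = _
    rw [hω]
  change ‖T x‖ = lorentzSum a q x ^ (1 / q)
  -- For `q < 1` this is only a `q`-norm, so nonnegativity is read off its definition.
  have h0 : 0 ≤ ‖T x‖ := by
    rw [Lp.norm_def]
    exact ENNReal.toReal_nonneg
  rw [← h1, ← Real.rpow_mul h0, mul_one_div_cancel hq.ne', Real.rpow_one]

theorem lorentzEmbedsInLq_of_eq {n : ℕ} {a : Fin n → ℝ} (ha : ∀ i, 0 ≤ a i) {q : ℝ}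
    (hq : 0 < q) (h : ∀ i j, a i = a j) :
    LorentzEmbedsInLq a q (volume.restrict (Set.Ioo (0 : ℝ) 1)) := by
  refine IsLqRepresentable.lorentzEmbedsInLq hq ?_
  rcases Nat.eq_zero_or_pos n with rfl | hn
  · have : lorentzSum a q = fun _ => 0 := by funext x; simp [lorentzSum]
    rw [this]
    exact .zero
  · have e : lorentzSum a q = fun x => ∑ i, a ⟨0, hn⟩ * |x i| ^ q := by
      funext x
      rw [← Finset.mul_sum, ← lorentzSum_const, funext fun i => h i ⟨0, hn⟩]
    rw [e]
    exact .sum _ fun i _ => (IsLqRepresentable.abs_apply_rpow q i).const_mul (ha _)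

/-- The signs of b (the last weight) and d (the common difference) matter: only nonnegative
combinations stay in the cone. -/
theorem EqualDifferences.exists_eq {n : ℕ} (hn : 2 ≤ n) {a : Fin n → ℝ} (h : EqualDifferences a)
    (ha_anti : Antitone a) (ha : ∀ i, 0 ≤ a i) :
    ∃ b d : ℝ, 0 ≤ b ∧ 0 ≤ d ∧ a = fun k : Fin n => b + d * ((n : ℝ) - 1 - k) := by
  refine ⟨a ⟨n - 1, by omega⟩, a ⟨0, by omega⟩ - a ⟨1, by omega⟩, ha _,
    sub_nonneg.2 (ha_anti (by simp)), ?_⟩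
  have key : ∀ (m : ℕ) (hm : m < n), a ⟨m, hm⟩ =
      a ⟨0, by omega⟩ - (a ⟨0, by omega⟩ - a ⟨1, by omega⟩) * m := by
    intro m
    induction m with
    | zero => intro _; simp
    | succ m ih =>
      intro hm
      have h1 := h m 0 hm (by omega)
      have h2 := ih (by omega)
      push_cast
      simp only [zero_add] at h1
      linarith
  funext k
  rw [key k k.isLt, key (n - 1) (by omega), Nat.cast_sub (by omega)]
  push_cast
  ring

theorem EqualDifferences.lorentzEmbedsInLq {n : ℕ} (hn : 2 ≤ n) {a : Fin n → ℝ}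
    (h : EqualDifferences a) (ha_anti : Antitone a) (ha : ∀ i, 0 ≤ a i) {q : ℝ} (hq : 0 < q)
    (hq1 : q ≤ 1) : LorentzEmbedsInLq a q (volume.restrict (Set.Ioo (0 : ℝ) 1)) := by
  refine IsLqRepresentable.lorentzEmbedsInLq hq ?_
  obtain ⟨b, d, hb, hd, rfl⟩ := h.exists_eq hn ha_anti ha
  rw [funext fun x => lorentzSum_eq_sum_max q b d x]
  refine .add (.sum _ fun i _ => .sum _ fun j _ => ?_)
    (.sum _ fun i _ => (IsLqRepresentable.abs_apply_rpow q i).const_mul hb)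
  split_ifs
  · exact (IsLqRepresentable.max_rpow hq hq1 i j).const_mul (by positivity)
  · exact .zero

theorem lorentzNorm_const {n : ℕ} {c : ℝ} (hc : 0 ≤ c) {q : ℝ} (hq : 0 < q) (x : Fin n → ℝ) :
    lorentzNorm (fun _ => c) q x = c ^ (1 / q) * ‖WithLp.toLp (ENNReal.ofReal q) x‖ := by
  have hq' : 0 < (ENNReal.ofReal q).toReal := by rwa [ENNReal.toReal_ofReal hq.le]
  change lorentzSum (fun _ => c) q x ^ (1 / q) = _
  rw [lorentzSum_const, Real.mul_rpow hc (Finset.sum_nonneg fun i _ => by positivity),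
    PiLp.norm_eq_sum hq', ENNReal.toReal_ofReal hq.le]
  simp only [Real.norm_eq_abs]

theorem theorem1 {n : ℕ} (hn : 2 ≤ n) (a : Fin n → ℝ) (ha_anti : Antitone a)
    (ha_nonneg : ∀ i, 0 ≤ a i) (ha_ne : ∃ i, a i ≠ 0) (q : ℝ) (hq : 0 < q) :
    (q ≤ 1 →
      (LorentzEmbedsInLq a q (volume.restrict (Set.Ioo (0 : ℝ) 1)) ↔ EqualDifferences a) ∧
      (∀ {Ω : Type*} [MeasurableSpace Ω] (μ : Measure Ω),
        LorentzEmbedsInLq a q μ → EqualDifferences a) ∧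
      (n = 2 → LorentzEmbedsInLq a q (volume.restrict (Set.Ioo (0 : ℝ) 1)))) ∧
    (1 < q →
      (LorentzEmbedsInLq a q (volume.restrict (Set.Ioo (0 : ℝ) 1)) ↔ ∀ i j, a i = a j) ∧
      (∀ {Ω : Type*} [MeasurableSpace Ω] (μ : Measure Ω),
        LorentzEmbedsInLq a q μ → ∀ i j, a i = a j) ∧
      (∀ c : ℝ, (∀ i, a i = c) → ∀ x : Fin n → ℝ,
        lorentzNorm a q x = c ^ (1 / q) * ‖WithLp.toLp (ENNReal.ofReal q) x‖)) := by
  refine ⟨fun hq1 => ?_, fun hq1 => ?_⟩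
  · have hq2 : q < 2 := by linarith
    have hsuff : EqualDifferences a →
        LorentzEmbedsInLq a q (volume.restrict (Set.Ioo (0 : ℝ) 1)) := fun h =>
      h.lorentzEmbedsInLq hn ha_anti ha_nonneg hq hq1
    refine ⟨⟨fun h => h.equalDifferences ha_nonneg hq hq2, hsuff⟩,
      fun μ h => h.equalDifferences ha_nonneg hq hq2, fun hn2 => hsuff ?_⟩
    intro i j hi hj
    obtain rfl : i = 0 := by omega
    obtain rfl : j = 0 := by omega
    rfl
  · refine ⟨⟨fun h => h.eq_of_one_lt ha_nonneg hq1, lorentzEmbedsInLq_of_eq ha_nonneg hq⟩,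
      fun μ h => h.eq_of_one_lt ha_nonneg hq1, fun c hc x => ?_⟩
    obtain rfl : a = fun _ => c := funext hc
    exact lorentzNorm_const (ha_nonneg ⟨0, by omega⟩) hq x
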